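/- For a positive integer $m$, let $\Omega(m)$ denote the number of prime factors of $m$ counted with multiplicity, and let $\lambda(m) := (-1)^{\Omega(m)}$ be the Liouville function. Then, as the real variable $x$ tends to infinity, $$\sum_{n\le x} \lambda(n!)\,\lambda((n+1)!) = o(x),$$ where the sum runs over all positive integers $n\le x$. -/

import Mathlib

open scoped Nat Asymptotics

/-! Since λ is completely multiplicative with values ±1, λ(n!)λ((n+1)!) = λ(n+1), so the claim is
that L(x) = ∑_{k≤x} λ(k) is o(x), a form of the prime number theorem. The function L(e^t)e^{-t} is
bounded and slowly oscillating, and its Laplace transform is ζ(2s+2)/((s+1)ζ(s+1)). This extends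
continuously to Re s ≥ 0 because ζ has no zeros on Re s = 1 and its pole at 1 becomes a zero of 1/ζ.
`tendsto_zero_of_laplace_continuousOn` then gives the limit 0: averages against a band-limited
kernel vanish by Riemann–Lebesgue, and slow oscillation removes the averaging. -/

/-! ### A Tauberian theorem for Laplace transforms. -/

open Filter Topology MeasureTheory Set in
open scoped FourierTransform SchwartzMap in
/-- Parseval's identity for a function weighted by a decaying exponential. -/
theorem integral_mul_cexp_mul_fourier_sub {f : ℝ → ℂ} {σ u : ℝ} (ψ : 𝓢(ℝ, ℂ))
    (hf : Integrable fun t : ℝ ↦ f t * Complex.exp (-(σ * t : ℂ))) :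
    ∫ t : ℝ, (f t * Complex.exp (-(σ * t : ℂ))) * 𝓕 (ψ : ℝ → ℂ) (t - u) =
      ∫ v : ℝ, Real.fourierChar (v * u) • (ψ v *
        ∫ t : ℝ, f t * Complex.exp (-((σ + 2 * Real.pi * v * Complex.I) * t : ℂ))) := by
  have hψ : Integrable fun v : ℝ ↦ Real.fourierChar (v * u) • ψ v := by
    refine ψ.integrable.mono ?_ (by simp)
    exact (Continuous.smul (by fun_prop) ψ.continuous).aestronglyMeasurable
  have key := VectorFourier.integral_fourierIntegral_smul_eq_flip (L := innerₗ ℝ)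
    (μ := volume) (ν := volume) Real.continuous_fourierChar continuous_inner hψ hf
  calc _ = ∫ ξ : ℝ, 𝓕 (fun v : ℝ ↦ Real.fourierChar (v * u) • ψ v) ξ •
        (f ξ * Complex.exp (-(σ * ξ : ℂ))) := by
        congr 1 with t
        rw [smul_eq_mul, mul_comm]
        congr 1
        simp only [Real.fourier_real_eq]
        congr 1 with v
        rw [← mul_smul, ← AddChar.map_add_eq_mul]
        ring_nf
    _ = _ := key
    _ = _ := by
        congr 1 with v
        rw [flip_innerₗ, Circle.smul_def, Circle.smul_def, smul_eq_mul, smul_eq_mul, smul_eq_mul,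
          mul_assoc]
        congr 2
        change 𝓕 (fun t : ℝ ↦ f t * Complex.exp (-(σ * t : ℂ))) v = _
        rw [Real.fourier_real_eq_integral_exp_smul]
        congr 1 with t
        rw [smul_eq_mul, mul_left_comm, ← Complex.exp_add]
        push_cast
        ring_nf

open Filter Topology MeasureTheory Set in
open scoped FourierTransform SchwartzMap in
/-- If the Laplace transform of a bounded function extends continuously to the closed half plane,
then averages of the function against translates of a band-limited Schwartz kernel tend to `0`. -/
theorem tendsto_integral_mul_fourier_sub {f : ℝ → ℂ} (hm : Measurable f) {B : ℝ}
    (hB : ∀ t, ‖f t‖ ≤ B) (h0 : ∀ t < 0, f t = 0) {G : ℂ → ℂ}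
    (hG : ContinuousOn G {s | 0 ≤ s.re})
    (hfG : ∀ s : ℂ, 0 < s.re → ∫ t : ℝ, f t * Complex.exp (-(s * t)) = G s)
    (ψ : 𝓢(ℝ, ℂ)) (hψ : HasCompactSupport ψ) :
    Tendsto (fun u : ℝ ↦ ∫ t : ℝ, f t * 𝓕 (ψ : ℝ → ℂ) (t - u)) atTop (𝓝 0) := by
  have hB0 : 0 ≤ B := (norm_nonneg _).trans (hB 0)
  have hdom (σ : ℝ) (hσ : 0 < σ) (t : ℝ) : ‖f t * Complex.exp (-(σ * t : ℂ))‖ ≤ B := by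
    rcases lt_or_ge t 0 with ht | ht
    · simpa [h0 t ht]
    · rw [norm_mul, Complex.norm_exp]
      refine (mul_le_of_le_one_right (norm_nonneg _) ?_).trans (hB t)
      simpa using by positivity
  have hint (σ : ℝ) (hσ : 0 < σ) : Integrable fun t : ℝ ↦ f t * Complex.exp (-(σ * t : ℂ)) := by
    have h1 : IntegrableOn (fun t : ℝ ↦ B * Real.exp (-σ * t)) (Ici 0) :=
      ((integrableOn_Ici_iff_integrableOn_Ioi).2 (exp_neg_integrableOn_Ioi 0 hσ)).const_mul B
    refine ((integrable_indicator_iff measurableSet_Ici).2 h1).mono'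
      (by fun_prop) (.of_forall fun t ↦ ?_)
    rcases lt_or_ge t 0 with ht | ht
    · simp [h0 t ht, ht]
    · rw [indicator_of_mem (by exact ht), norm_mul, Complex.norm_exp]
      gcongr
      · exact hB t
      · simp
  have hK : Integrable (𝓕 (ψ : ℝ → ℂ)) := (𝓕 ψ).integrable
  have hKc : Continuous (𝓕 (ψ : ℝ → ℂ)) := (𝓕 ψ).continuous
  have hline (v : ℝ) (σ : ℝ) (hσ : 0 ≤ σ) :
      (σ + 2 * Real.pi * v * Complex.I : ℂ) ∈ {s : ℂ | 0 ≤ s.re} := by simpa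
  -- Let σ → 0+ in Parseval's identity; compact support of ψ keeps `G` bounded on the segments
  -- involved.
  have hid (u : ℝ) : ∫ t : ℝ, f t * 𝓕 (ψ : ℝ → ℂ) (t - u) =
      ∫ v : ℝ, Real.fourierChar (v * u) • (ψ v * G (2 * Real.pi * v * Complex.I)) := by
    have hL : Tendsto (fun σ : ℝ ↦
        ∫ t : ℝ, (f t * Complex.exp (-(σ * t : ℂ))) * 𝓕 (ψ : ℝ → ℂ) (t - u)) (𝓝[>] 0)
        (𝓝 (∫ t : ℝ, f t * 𝓕 (ψ : ℝ → ℂ) (t - u))) := by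
      refine tendsto_integral_filter_of_dominated_convergence
        (fun t ↦ B * ‖𝓕 (ψ : ℝ → ℂ) (t - u)‖) ?_ ?_ ?_ ?_
      · exact .of_forall fun σ ↦ by fun_prop
      · filter_upwards [self_mem_nhdsWithin] with σ hσ
        refine .of_forall fun t ↦ ?_
        rw [norm_mul]
        gcongr
        exact hdom σ hσ t
      · exact (hK.comp_sub_right u).norm.const_mul B
      · refine .of_forall fun t ↦ ?_
        have : Continuous fun σ : ℝ ↦
          (f t * Complex.exp (-(σ * t : ℂ))) * 𝓕 (ψ : ℝ → ℂ) (t - u) := by fun_prop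
        simpa using (this.tendsto 0).mono_left nhdsWithin_le_nhds
    have hR : Tendsto (fun σ : ℝ ↦ ∫ v : ℝ, Real.fourierChar (v * u) • (ψ v *
        G (σ + 2 * Real.pi * v * Complex.I))) (𝓝[>] 0)
        (𝓝 (∫ v : ℝ, Real.fourierChar (v * u) • (ψ v * G (2 * Real.pi * v * Complex.I)))) := by
      have hcpt : IsCompact ((fun p : ℝ × ℝ ↦ (p.1 + 2 * Real.pi * p.2 * Complex.I : ℂ)) ''
          (Icc 0 1 ×ˢ tsupport ψ)) := (isCompact_Icc.prod hψ).image (by fun_prop)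
      obtain ⟨C, hC⟩ := hcpt.exists_bound_of_continuousOn
        (hG.mono (by rintro _ ⟨⟨σ, v⟩, ⟨h1, -⟩, rfl⟩; exact hline v σ h1.1))
      refine tendsto_integral_filter_of_dominated_convergence (fun v ↦ ‖ψ v‖ * C) ?_ ?_ ?_ ?_
      · filter_upwards [self_mem_nhdsWithin] with σ (hσ : 0 < σ)
        refine Continuous.aestronglyMeasurable (.smul (by fun_prop) (.mul ψ.continuous ?_))
        exact hG.comp_continuous (by fun_prop) fun v ↦ hline v σ hσ.le
      · filter_upwards [Ioc_mem_nhdsGT zero_lt_one] with σ hσ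
        refine .of_forall fun v ↦ ?_
        rw [Circle.norm_smul, norm_mul]
        by_cases hv : ψ v = 0
        · simp [hv]
        gcongr
        exact hC _ ⟨(σ, v), ⟨⟨hσ.1.le, hσ.2⟩, subset_tsupport _ hv⟩, rfl⟩
      · exact ψ.integrable.norm.mul_const C
      · refine .of_forall fun v ↦ Tendsto.const_smul (Tendsto.const_mul _ ?_) _
        have h1 := hG _ (hline v 0 le_rfl)
        have h2 : Tendsto (fun σ : ℝ ↦ (σ + 2 * Real.pi * v * Complex.I : ℂ)) (𝓝[>] 0)
            (𝓝[{s | 0 ≤ s.re}] ((0 : ℝ) + 2 * Real.pi * v * Complex.I)) := by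
          refine tendsto_nhdsWithin_iff.2 ⟨?_, ?_⟩
          · exact (Continuous.tendsto (f := fun σ : ℝ ↦
              (σ + 2 * Real.pi * v * Complex.I : ℂ)) (by fun_prop) 0).mono_left nhdsWithin_le_nhds
          · filter_upwards [self_mem_nhdsWithin] with σ hσ using hline v σ (le_of_lt hσ)
        simpa [Function.comp_def] using h1.tendsto.comp h2
    refine tendsto_nhds_unique hL (hR.congr' ?_)
    filter_upwards [self_mem_nhdsWithin] with σ (hσ : 0 < σ)
    rw [integral_mul_cexp_mul_fourier_sub ψ (hint σ hσ)]
    congr 1 with v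
    rw [hfG _ (by simpa)]
  have hRL := Real.tendsto_integral_exp_smul_cocompact
    (fun v : ℝ ↦ ψ v * G (2 * Real.pi * v * Complex.I))
  have hneg : Tendsto (fun u : ℝ ↦ -u) atTop (cocompact ℝ) :=
    tendsto_neg_atTop_atBot.mono_right atBot_le_cocompact
  refine (hRL.comp hneg).congr fun u ↦ ?_
  simp [hid]

open Filter Topology MeasureTheory Set in
open scoped FourierTransform SchwartzMap in
/-- A bounded function with oscillation at most `C * |t - u| + η u`, where `η` tends to `0`, is
eventually bounded by any number exceeding `C * ∫ |t| * |𝓕 ψ t|`, provided that its averages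
against `𝓕 ψ` tend to `0`, where `ψ 0 = 1`. -/
theorem eventually_norm_lt_of_tendsto_integral_mul_fourier_sub {f : ℝ → ℂ} (hm : Measurable f)
    {B : ℝ} (hB : ∀ t, ‖f t‖ ≤ B) {C : ℝ} {η : ℝ → ℝ} (hη : Tendsto η atTop (𝓝 0))
    (hosc : ∀ t u, ‖f t - f u‖ ≤ C * |t - u| + η u) (ψ : 𝓢(ℝ, ℂ)) (hψ : ψ 0 = 1)
    (h : Tendsto (fun u : ℝ ↦ ∫ t : ℝ, f t * 𝓕 (ψ : ℝ → ℂ) (t - u)) atTop (𝓝 0))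
    {ε : ℝ} (hε : C * ∫ t : ℝ, |t| * ‖𝓕 (ψ : ℝ → ℂ) t‖ < ε) :
    ∀ᶠ u in atTop, ‖f u‖ < ε := by
  have hK : Integrable (𝓕 (ψ : ℝ → ℂ)) := (𝓕 ψ).integrable
  have hK1 : Integrable fun t : ℝ ↦ |t| * ‖𝓕 (ψ : ℝ → ℂ) t‖ := by
    have := (𝓕 ψ).integrable_pow_mul volume 1
    simp only [pow_one, Real.norm_eq_abs] at this
    exact this
  -- Fourier inversion at 0.
  have hKint : ∫ t : ℝ, 𝓕 (ψ : ℝ → ℂ) t = 1 := by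
    have := congrFun (ψ.continuous.fourierInv_fourier_eq ψ.integrable hK) 0
    rw [Real.fourierInv_eq, hψ] at this
    simpa using this
  have hbound (u : ℝ) : ‖f u‖ ≤ ‖∫ t : ℝ, f t * 𝓕 (ψ : ℝ → ℂ) (t - u)‖ +
      (C * (∫ t : ℝ, |t| * ‖𝓕 (ψ : ℝ → ℂ) t‖) + η u * ∫ t : ℝ, ‖𝓕 (ψ : ℝ → ℂ) t‖) := by
    have hKu := hK.comp_sub_right u
    have hfK : Integrable fun t : ℝ ↦ f t * 𝓕 (ψ : ℝ → ℂ) (t - u) :=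
      hKu.bdd_mul hm.aestronglyMeasurable (.of_forall hB)
    have h1 : f u = (∫ t : ℝ, f t * 𝓕 (ψ : ℝ → ℂ) (t - u)) -
        ∫ t : ℝ, (f t - f u) * 𝓕 (ψ : ℝ → ℂ) (t - u) := by
      simp_rw [sub_mul]
      rw [integral_sub hfK (hKu.const_mul _), integral_const_mul,
        integral_sub_right_eq_self (𝓕 (ψ : ℝ → ℂ)) u, hKint]
      ring
    have h2 : ‖∫ t : ℝ, (f t - f u) * 𝓕 (ψ : ℝ → ℂ) (t - u)‖ ≤
        C * (∫ t : ℝ, |t| * ‖𝓕 (ψ : ℝ → ℂ) t‖) + η u * ∫ t : ℝ, ‖𝓕 (ψ : ℝ → ℂ) t‖ := by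
      have h3 : Integrable fun t : ℝ ↦ C * (|t| * ‖𝓕 (ψ : ℝ → ℂ) t‖) +
          η u * ‖𝓕 (ψ : ℝ → ℂ) t‖ := (hK1.const_mul C).add (hK.norm.const_mul (η u))
      rw [← integral_const_mul, ← integral_const_mul,
        ← integral_add (hK1.const_mul C) (hK.norm.const_mul (η u)),
        ← integral_sub_right_eq_self (fun t : ℝ ↦ C * (|t| * ‖𝓕 (ψ : ℝ → ℂ) t‖) +
          η u * ‖𝓕 (ψ : ℝ → ℂ) t‖) u]
      refine norm_integral_le_of_norm_le (h3.comp_sub_right u) (.of_forall fun t ↦ ?_)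
      rw [norm_mul, ← mul_assoc, ← add_mul]
      gcongr
      exact hosc t u
    calc ‖f u‖ = ‖_‖ := congrArg _ h1
      _ ≤ _ := norm_sub_le _ _
      _ ≤ _ := by gcongr
  have hlim := h.norm.add ((hη.mul_const (∫ t : ℝ, ‖𝓕 (ψ : ℝ → ℂ) t‖)).const_add
    (C * ∫ t : ℝ, |t| * ‖𝓕 (ψ : ℝ → ℂ) t‖))
  filter_upwards [hlim.eventually_lt_const (by simpa using hε)] with u hu
  exact (hbound u).trans_lt hu

open Filter Topology MeasureTheory Set in
open scoped FourierTransform SchwartzMap in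
/-- A Tauberian theorem: a bounded, slowly oscillating function on the half line tends to `0` if its
Laplace transform extends continuously to the closed right half plane. -/
theorem tendsto_zero_of_laplace_continuousOn {f : ℝ → ℂ} (hm : Measurable f) {B : ℝ}
    (hB : ∀ t, ‖f t‖ ≤ B) (h0 : ∀ t < 0, f t = 0) {C : ℝ} {η : ℝ → ℝ}
    (hη : Tendsto η atTop (𝓝 0)) (hosc : ∀ t u, ‖f t - f u‖ ≤ C * |t - u| + η u) {G : ℂ → ℂ}
    (hG : ContinuousOn G {s | 0 ≤ s.re})
    (hfG : ∀ s : ℂ, 0 < s.re → ∫ t : ℝ, f t * Complex.exp (-(s * t)) = G s) :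
    Tendsto f atTop (𝓝 0) := by
  let b : ContDiffBump (0 : ℝ) := default
  have hbc : HasCompactSupport fun x ↦ (b x : ℂ) :=
    b.hasCompactSupport.comp_left (g := Complex.ofReal) Complex.ofReal_zero
  let ψ : 𝓢(ℝ, ℂ) := hbc.toSchwartzMap (Complex.ofRealCLM.contDiff.comp b.contDiff)
  have hψ : ψ 0 = 1 := by
    change (b 0 : ℂ) = 1
    simp [b.one_of_mem_closedBall (Metric.mem_closedBall_self b.rIn_pos.le)]
  set A := ∫ t : ℝ, |t| * ‖𝓕 (ψ : ℝ → ℂ) t‖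
  refine NormedAddGroup.tendsto_nhds_zero.2 fun ε hε ↦ ?_
  -- rescale `f` so that it oscillates slowly enough
  obtain ⟨T, hT, hT0⟩ : ∃ T : ℝ, T⁻¹ * (C * A) < ε ∧ 0 < T :=
    (((by simpa using tendsto_inv_atTop_zero.mul_const (C * A) :
      Tendsto (fun T : ℝ ↦ T⁻¹ * (C * A)) atTop (𝓝 0)).eventually_lt_const hε).and
      (eventually_gt_atTop 0)).exists
  -- Dilating time by `T` divides `C` by `T`, leaves the kernel fixed and turns G(s) into T·G(Ts).
  have hG' : ContinuousOn (fun s ↦ T * G (T * s)) {s : ℂ | 0 ≤ s.re} := by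
    refine continuousOn_const.mul (hG.comp (by fun_prop) fun s hs ↦ ?_)
    simpa using mul_nonneg hT0.le hs
  have key := tendsto_integral_mul_fourier_sub (f := fun t ↦ f (T⁻¹ * t)) (by fun_prop)
    (fun t ↦ hB _) (fun t ht ↦ h0 _ (mul_neg_of_pos_of_neg (inv_pos.2 hT0) ht)) hG'
    (fun s hs ↦ by
      rw [← hfG _ (by simpa using mul_pos hT0 hs)]
      have := Measure.integral_comp_mul_left
        (fun t : ℝ ↦ f t * Complex.exp (-(T * s * t))) T⁻¹
      rw [inv_inv, abs_of_pos hT0, Complex.real_smul] at this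
      rw [← this]
      congr 1 with t
      have : (T : ℂ) ≠ 0 := by exact_mod_cast hT0.ne'
      congr 3
      push_cast
      field_simp) ψ hbc
  have hev := eventually_norm_lt_of_tendsto_integral_mul_fourier_sub
    (f := fun t ↦ f (T⁻¹ * t)) (by fun_prop) (fun t ↦ hB _) (C := T⁻¹ * C)
    (hη.comp (tendsto_id.const_mul_atTop (inv_pos.2 hT0))) (fun t u ↦ by
      refine (hosc _ _).trans_eq ?_
      rw [← mul_sub, abs_mul, abs_of_pos (inv_pos.2 hT0)]
      simp only [Function.comp, id]
      ring) ψ hψ key (ε := ε) (by rwa [mul_assoc])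
  filter_upwards [(tendsto_id.const_mul_atTop hT0).eventually hev] with t ht
  simpa [hT0.ne'] using ht

/-! ### The Dirichlet series of λ and 1/ζ on Re s ≥ 1. -/

open Complex in
/-- The Dirichlet series of the Liouville function is `ζ(2s) / ζ(s)`. -/
theorem LSeries_liouville_mul_riemannZeta {s : ℂ} (hs : 1 < s.re) :
    LSeries (fun n ↦ (ArithmeticFunction.liouville n : ℂ)) s * riemannZeta s =
      riemannZeta (2 * s) := by
  have hs0 := ne_zero_of_one_lt_re hs
  let F : ℕ →*₀ ℂ :=
    { toFun := fun n ↦ ArithmeticFunction.liouville n * riemannZetaSummandHom hs0 n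
      map_zero' := by simp
      map_one' := by simp [ArithmeticFunction.liouville_apply_one]
      map_mul' := fun m n ↦ by
        rw [ArithmeticFunction.liouville_apply_mul, map_mul]
        push_cast
        ring }
  have hF (n : ℕ) : F n = ArithmeticFunction.liouville n * (n : ℂ) ^ (-s) := rfl
  have hsum : Summable (fun n ↦ ‖F n‖) := by
    refine (summable_riemannZetaSummand hs).congr fun n ↦ ?_
    rcases eq_or_ne n 0 with rfl | hn
    · simp
    · change _ = ‖(ArithmeticFunction.liouville n * riemannZetaSummandHom hs0 n : ℂ)‖
      simp [ArithmeticFunction.liouville_apply hn]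
  have h1 := EulerProduct.eulerProduct_completely_multiplicative_hasProd hsum
  have hL : ∑' n, F n = LSeries (fun n ↦ (ArithmeticFunction.liouville n : ℂ)) s := by
    refine tsum_congr fun n ↦ ?_
    rw [LSeries.term_of_ne_zero' hs0, hF, cpow_neg, div_eq_mul_inv]
  rw [hL] at h1
  have h2 := h1.mul (riemannZeta_eulerProduct_hasProd hs)
  have h3 := riemannZeta_eulerProduct_hasProd (s := 2 * s) (by simp; linarith)
  -- Euler factors: (1 + p^{-s})(1 - p^{-s}) = 1 - p^{-2s}.
  refine h2.unique (h3.congr_fun fun p ↦ ?_)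
  rw [hF, ← mul_inv, ArithmeticFunction.liouville_apply p.2.ne_zero,
    ArithmeticFunction.cardFactors_apply_prime p.2, ← mul_neg, two_mul,
    ← two_mul, mul_comm (2 : ℂ), cpow_mul_ofNat]
  congr 1
  push_cast
  ring

theorem continuous_update_sub_one_mul_riemannZeta :
    Continuous (Function.update (fun s ↦ (s - 1) * riemannZeta s) 1 1) := by
  refine continuous_iff_continuousAt.2 fun s ↦ ?_
  rcases eq_or_ne s 1 with rfl | hs
  · exact continuousAt_update_same.2 riemannZeta_residue_one
  · rw [continuousAt_update_of_ne hs]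
    exact ContinuousAt.mul (by fun_prop) (differentiableAt_riemannZeta hs).continuousAt

/-- The value 0 at s = 1 is the limit forced by the pole; `riemannZeta 1` itself is a finite default
value. Writing 1/ζ as (s-1)/((s-1)ζ) makes the continuity visible. -/
theorem continuousOn_inv_riemannZeta :
    ContinuousOn (fun s ↦ if s = 1 then 0 else (riemannZeta s)⁻¹) {s | 1 ≤ s.re} := by
  have hne (s : ℂ) (hs : 1 ≤ s.re) :
      Function.update (fun s ↦ (s - 1) * riemannZeta s) 1 1 s ≠ 0 := by
    rcases eq_or_ne s 1 with rfl | h1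
    · simp
    · rw [Function.update_of_ne h1]
      exact mul_ne_zero (sub_ne_zero.2 h1) (riemannZeta_ne_zero_of_one_le_re hs)
  refine ContinuousOn.congr (f := fun s ↦ (s - 1) *
    (Function.update (fun s ↦ (s - 1) * riemannZeta s) 1 1 s)⁻¹) ?_ fun s hs ↦ ?_
  · exact ContinuousOn.mul (by fun_prop)
      (continuous_update_sub_one_mul_riemannZeta.continuousOn.inv₀ hne)
  · rcases eq_or_ne s 1 with rfl | h1
    · simp
    · have := sub_ne_zero.2 h1
      simp only [h1, if_false, Function.update_of_ne h1, mul_inv, mul_inv_cancel_left₀ this]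

/-! ### Bounds, oscillation and Laplace transform of L(e^t)e^{-t}. -/

theorem norm_sum_liouville_sub_le {x y : ℝ} (hxy : x ≤ y) :
    ‖∑ k ∈ Finset.Icc 1 ⌊y⌋₊, (ArithmeticFunction.liouville k : ℂ) -
      ∑ k ∈ Finset.Icc 1 ⌊x⌋₊, (ArithmeticFunction.liouville k : ℂ)‖ ≤ ⌊y⌋₊ - ⌊x⌋₊ := by
  have hfl := Nat.floor_mono hxy
  rw [← Finset.sum_sdiff (Finset.Icc_subset_Icc_right hfl), add_sub_cancel_right]
  refine (norm_sum_le_of_le (f := fun k ↦ (ArithmeticFunction.liouville k : ℂ)) _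
    (n := fun _ ↦ 1) fun k hk ↦ ?_).trans_eq ?_
  · have : k ≠ 0 := by
      have := (Finset.mem_Icc.1 (Finset.mem_sdiff.1 hk).1).1
      lia
    simp [ArithmeticFunction.liouville_apply this]
  · rw [Finset.sum_const, Finset.card_sdiff_of_subset (Finset.Icc_subset_Icc_right hfl)]
    simp [Nat.cast_sub hfl]

theorem norm_sum_liouville_le {x : ℝ} (hx : 0 ≤ x) :
    ‖∑ k ∈ Finset.Icc 1 ⌊x⌋₊, (ArithmeticFunction.liouville k : ℂ)‖ ≤ x := by
  have := norm_sum_liouville_sub_le hx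
  simp only [Nat.floor_zero, Nat.cast_zero, sub_zero] at this
  simpa using this.trans (Nat.floor_le hx)

/-- The normalized summatory function of the Liouville function, in logarithmic scale. -/
noncomputable def liouvilleMean (t : ℝ) : ℂ :=
  (∑ k ∈ Finset.Icc 1 ⌊Real.exp t⌋₊, (ArithmeticFunction.liouville k : ℂ)) * Real.exp (-t)

theorem measurable_liouvilleMean : Measurable liouvilleMean := by
  refine .mul ?_ (by fun_prop)
  exact (measurable_from_nat (f := fun n ↦
    ∑ k ∈ Finset.Icc 1 n, (ArithmeticFunction.liouville k : ℂ))).comp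
      (Nat.measurable_floor.comp Real.measurable_exp)

theorem norm_liouvilleMean_le (t : ℝ) : ‖liouvilleMean t‖ ≤ 1 := by
  rw [liouvilleMean, norm_mul, Complex.norm_real, Real.norm_of_nonneg (Real.exp_nonneg _)]
  calc _ ≤ Real.exp t * Real.exp (-t) := by
        gcongr
        exact norm_sum_liouville_le (Real.exp_nonneg t)
    _ = 1 := by rw [← Real.exp_add]; simp

theorem liouvilleMean_of_neg {t : ℝ} (ht : t < 0) : liouvilleMean t = 0 := by
  simp [liouvilleMean, Nat.floor_eq_zero.2 (Real.exp_lt_one_iff.2 ht)]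

/-- The change of the sum and the change of the weight each contribute 1 - e^{u-t} ≤ t - u; rounding
in the floors adds e^{-t}. -/
theorem norm_liouvilleMean_sub_le_of_le {t u : ℝ} (h : u ≤ t) :
    ‖liouvilleMean t - liouvilleMean u‖ ≤ 2 * (t - u) + Real.exp (-t) := by
  have h1 := norm_sum_liouville_sub_le (Real.exp_le_exp.2 h)
  have h2 := norm_sum_liouville_le (Real.exp_nonneg u)
  unfold liouvilleMean
  set M := ∑ k ∈ Finset.Icc 1 ⌊Real.exp t⌋₊, (ArithmeticFunction.liouville k : ℂ)
  set N := ∑ k ∈ Finset.Icc 1 ⌊Real.exp u⌋₊, (ArithmeticFunction.liouville k : ℂ)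
  have h3 : ‖M - N‖ ≤ Real.exp t - Real.exp u + 1 := by
    linarith [Nat.floor_le (Real.exp_nonneg t), Nat.lt_floor_add_one (Real.exp u)]
  have h4 : Real.exp (-t) ≤ Real.exp (-u) := Real.exp_le_exp.2 (by linarith)
  have h5 : Real.exp u * Real.exp (-t) = Real.exp (u - t) := by rw [← Real.exp_add]; ring_nf
  have h6 (a : ℝ) : Real.exp a * Real.exp (-a) = 1 := by rw [← Real.exp_add]; simp
  have h7 := Real.add_one_le_exp (u - t)
  calc ‖M * Real.exp (-t) - N * Real.exp (-u)‖
      = ‖(M - N) * Real.exp (-t) - N * ((Real.exp (-u) - Real.exp (-t) : ℝ) : ℂ)‖ := by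
        push_cast
        ring_nf
    _ ≤ ‖(M - N) * Real.exp (-t)‖ + ‖N * ((Real.exp (-u) - Real.exp (-t) : ℝ) : ℂ)‖ :=
        norm_sub_le _ _
    _ = ‖M - N‖ * Real.exp (-t) + ‖N‖ * (Real.exp (-u) - Real.exp (-t)) := by
        rw [norm_mul, norm_mul, Complex.norm_real, Complex.norm_real,
          Real.norm_of_nonneg (Real.exp_nonneg _), Real.norm_of_nonneg (sub_nonneg.2 h4)]
    _ ≤ (Real.exp t - Real.exp u + 1) * Real.exp (-t) +
          Real.exp u * (Real.exp (-u) - Real.exp (-t)) := by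
        gcongr
    _ = 2 * (1 - Real.exp (u - t)) + Real.exp (-t) := by linear_combination h6 t + h6 u - 2 * h5
    _ ≤ _ := by linarith

theorem norm_liouvilleMean_sub_le (t u : ℝ) :
    ‖liouvilleMean t - liouvilleMean u‖ ≤ 2 * |t - u| + Real.exp (-u) := by
  rcases le_total u t with h | h
  · rw [abs_of_nonneg (sub_nonneg.2 h)]
    have := Real.exp_le_exp.2 (neg_le_neg h)
    linarith [norm_liouvilleMean_sub_le_of_le h]
  · rw [norm_sub_rev, abs_sub_comm, abs_of_nonneg (sub_nonneg.2 h)]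
    exact norm_liouvilleMean_sub_le_of_le h

-- Abel summation, followed by the substitution x = e^t.
open MeasureTheory Set in
theorem add_one_mul_integral_liouvilleMean {s : ℂ} (hs : 0 < s.re) :
    (s + 1) * ∫ t : ℝ, liouvilleMean t * Complex.exp (-(s * t)) =
      LSeries (fun n ↦ (ArithmeticFunction.liouville n : ℂ)) (s + 1) := by
  have hO : (fun n : ℕ ↦ ∑ k ∈ Finset.Icc 1 n, ‖(ArithmeticFunction.liouville k : ℂ)‖)
      =O[Filter.atTop] fun n ↦ (n : ℝ) ^ (1 : ℝ) := by
    refine Asymptotics.isBigO_of_le _ fun n ↦ ?_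
    rw [Finset.sum_congr rfl (g := fun _ ↦ (1 : ℝ)) fun k hk ↦ ?_]
    · simp
    · have : k ≠ 0 := by
        have := (Finset.mem_Icc.1 hk).1
        lia
      simp [ArithmeticFunction.liouville_apply this]
  rw [LSeries_eq_mul_integral' _ zero_le_one (by simpa) hO, ← Real.exp_zero,
    ← integral_comp_exp_Ioi, ← setIntegral_eq_integral_of_forall_compl_eq_zero (s := Ici 0)
      fun t ht ↦ by rw [liouvilleMean_of_neg (not_le.1 ht), zero_mul],
    integral_Ici_eq_integral_Ioi]
  congr 2 with t
  rw [liouvilleMean, Complex.real_smul, Complex.cpow_def_of_ne_zero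
    (by exact_mod_cast (Real.exp_pos t).ne'), ← Complex.ofReal_log (Real.exp_nonneg t),
    Real.log_exp, mul_left_comm, mul_assoc]
  push_cast
  rw [← Complex.exp_add, ← Complex.exp_add]
  ring_nf

open Filter Topology in
theorem tendsto_liouvilleMean : Tendsto liouvilleMean atTop (𝓝 0) := by
  have hone (s : ℂ) (hs : 0 ≤ s.re) : s + 1 ≠ 0 := fun h ↦ by
    have := congrArg Complex.re h
    simp at this
    linarith
  refine tendsto_zero_of_laplace_continuousOn measurable_liouvilleMean norm_liouvilleMean_le
    (fun t ↦ liouvilleMean_of_neg) (C := 2) (η := fun u ↦ Real.exp (-u))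
    (Real.tendsto_exp_neg_atTop_nhds_zero) norm_liouvilleMean_sub_le
    (G := fun s ↦ riemannZeta (2 * (s + 1)) *
      (if s + 1 = 1 then 0 else (riemannZeta (s + 1))⁻¹) / (s + 1)) ?_ fun s hs ↦ ?_
  · refine ContinuousOn.div (.mul ?_ ?_) (by fun_prop) hone
    · intro s (hs : 0 ≤ s.re)
      -- Here Re 2(s+1) ≥ 2, away from the pole of ζ.
      have h1 : 2 * (s + 1) ≠ 1 := fun h ↦ by
        have := congrArg Complex.re h
        simp at this
        linarith
      exact ((differentiableAt_riemannZeta h1).continuousAt.comp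
        (f := fun s ↦ 2 * (s + 1)) (by fun_prop)).continuousWithinAt
    · exact continuousOn_inv_riemannZeta.comp (f := fun s ↦ s + 1) (by fun_prop)
        fun s hs ↦ by simpa using hs
  · have hs1 : 1 < (s + 1).re := by simpa
    have h1 : s + 1 ≠ 1 := fun h ↦ by simp [h] at hs1
    rw [if_neg h1, eq_div_iff (hone s hs.le), mul_comm, add_one_mul_integral_liouvilleMean hs,
      eq_mul_inv_iff_mul_eq₀ (riemannZeta_ne_zero_of_one_lt_re hs1),
      LSeries_liouville_mul_riemannZeta hs1]

open Filter Topology in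
/-- The Liouville function has mean value `0`, a form of the prime number theorem. -/
theorem sum_liouville_isLittleO :
    (fun x : ℝ ↦ ∑ k ∈ Finset.Icc 1 ⌊x⌋₊, (ArithmeticFunction.liouville k : ℝ))
      =o[atTop] (fun x : ℝ ↦ x) := by
  rw [Asymptotics.isLittleO_iff_tendsto' (by
    filter_upwards [eventually_gt_atTop 0] with x hx h using absurd h hx.ne')]
  refine Complex.isUniformEmbedding_ofReal.isEmbedding.tendsto_nhds_iff.2 ?_
  refine (tendsto_liouvilleMean.comp Real.tendsto_log_atTop).congr' ?_
  filter_upwards [eventually_gt_atTop 0] with x hx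
  simp [liouvilleMean, Real.exp_neg, Real.exp_log hx, div_eq_mul_inv]

/-! ### Reduction of the factorials to L(x). -/

theorem liouville_mul_self {n : ℕ} (hn : n ≠ 0) :
    ArithmeticFunction.liouville n * ArithmeticFunction.liouville n = 1 := by
  rw [ArithmeticFunction.liouville_apply hn, ← mul_pow]
  simp

theorem liouville_factorial_mul_liouville_factorial_succ (n : ℕ) :
    ArithmeticFunction.liouville (n !) * ArithmeticFunction.liouville ((n + 1)!) =
      ArithmeticFunction.liouville (n + 1) := by
  rw [Nat.factorial_succ, ArithmeticFunction.liouville_apply_mul, mul_left_comm,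
    liouville_mul_self n.factorial_ne_zero, mul_one]

theorem mainTheorem1 :
    (fun x : ℝ => ∑ n ∈ Finset.Icc 1 ⌊x⌋₊,
      ((ArithmeticFunction.liouville (n !) * ArithmeticFunction.liouville ((n + 1)!) : ℤ) : ℝ))
      =o[Filter.atTop] (fun x : ℝ => x) := by
  -- Shifting n+1 to k gains the term at ⌊x⌋+1 and loses λ(1) = 1, an error of at most 2.
  have key (x : ℝ) : ∑ n ∈ Finset.Icc 1 ⌊x⌋₊,
      ((ArithmeticFunction.liouville (n !) * ArithmeticFunction.liouville ((n + 1)!) : ℤ) : ℝ) =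
      ∑ k ∈ Finset.Icc 1 ⌊x⌋₊, (ArithmeticFunction.liouville k : ℝ) +
        (ArithmeticFunction.liouville (⌊x⌋₊ + 1) - 1) := by
    simp_rw [liouville_factorial_mul_liouville_factorial_succ]
    induction ⌊x⌋₊ with
    | zero => simp [ArithmeticFunction.liouville_apply_one]
    | succ n ih =>
      rw [Finset.sum_Icc_succ_top (by lia), Finset.sum_Icc_succ_top (by lia), ih]
      ring
  simp_rw [key]
  refine sum_liouville_isLittleO.add (Asymptotics.IsBigO.trans_isLittleO (g := fun _ ↦ (1 : ℝ))
    (.of_bound 2 (.of_forall fun x ↦ ?_)) (Asymptotics.isLittleO_const_id_atTop 1))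
  refine (norm_sub_le _ _).trans ?_
  simp [ArithmeticFunction.liouville_apply (Nat.succ_ne_zero _)]
  norm_num
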